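/- **Theorem 1.** Let $\mathbf Y=(Y_t)_{t\in\mathbb Z}$ be a real-valued (not necessarily stationary) Markov process on a probability space $(\Omega,\mathcal F,\mathbb P)$. For each $t\in\mathbb Z$ let $C_{t,t+1}$ be a copula of the vector $(Y_t,Y_{t+1})$, that is, a bivariate distribution function on $[0,1]^2$ with uniform margins such that $\mathbb P(Y_t\le x,\,Y_{t+1}\le y)=C_{t,t+1}(F_t(x),F_{t+1}(y))$ for all $x,y\in\mathbb R$, where $F_s$ is the distribution function of $Y_s$. Assume that $C_{t,t+1}$ is absolutely continuous with a density $c_{t,t+1}$ that is symmetric, $c_{t,t+1}(u,v)=c_{t,t+1}(v,u)$ for almost all $(u,v)$, and square-integrable on $[0,1]^2$, and that $\sup_{t\in\mathbb Z}\|c_{t,t+1}\|_{L^2([0,1]^2)}<\infty$. Let $$\eta_t=\sup_{f,g}\left|\int_0^1\!\!\int_0^1 f(x)g(y)\,C_{t,t+1}(dx,dy)\right|$$ be the maximal correlation coefficient of $C_{t,t+1}$, where the supremum is over all $f,g\in L^2([0,1])$ with $\int_0^1 f=\int_0^1 g=0$ and $\int_0^1 f^2=\int_0^1 g^2=1$.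 For $k\ge 0$ let $$\beta_k=\sup_{t\in\mathbb Z}\ \sup_{\{A_i\},\{B_j\}}\ \frac12\sum_{i=1}^I\sum_{j=1}^J\bigl|\mathbb P(A_i\cap B_j)-\mathbb P(A_i)\mathbb P(B_j)\bigr|,$$ where the inner supremum is over all finite partitions $\{A_1,\dots,A_I\}$ and $\{B_1,\dots,B_J\}$ of $\Omega$ with $A_i\in\sigma(Y_s:s\le t)$ and $B_j\in\sigma(Y_s:s\ge t+k)$. If $$\hat\eta=\sup_{t\in\mathbb Z}\eta_t<1,$$ then $\mathbf Y$ is $\beta$-mixing, that is, $\beta_k\to0$ as $k\to\infty$. Moreover, for every $k\ge1$, $$\beta_k\le\tfrac12\,\hat\eta^{\,k-1}\,\sup_{t\in\mathbb Z}\|c_{t,t+1}-1\|_{L^2([0,1]^2)}$$ (with $\hat\eta^{\,0}=1$). -/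

import Mathlib

open MeasureTheory ProbabilityTheory Filter Topology
open scoped ENNReal NNReal

noncomputable section

/-- A (bivariate) copula: a probability law on the unit square both of whose marginals are
uniform on `[0,1]`. The associated distribution function is `Copula.cdf`. -/
structure Copula where
  /-- the law `C(dx, dy)` on the unit square -/
  law : Measure (unitInterval × unitInterval)
  /-- the first marginal is uniform -/
  map_fst : law.map Prod.fst = volume
  /-- the second marginal is uniform -/
  map_snd : law.map Prod.snd = volume

/-- The distribution function `C(u, v)` of a copula. -/
def Copula.cdf (C : Copula) (u v : unitInterval) : ℝ :=
  C.law.real (Set.Iic u ×ˢ Set.Iic v)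

/-- `c` is a density of the copula `C` with respect to Lebesgue measure on the unit square. -/
structure Copula.HasDensity (C : Copula) (c : unitInterval × unitInterval → ℝ) : Prop where
  aemeasurable : AEMeasurable c volume
  nonneg : ∀ᵐ z, 0 ≤ c z
  law_eq : C.law = volume.withDensity (fun z => ENNReal.ofReal (c z))

/-- A function in `L²([0,1])` with mean zero and unit second moment. -/
structure IsStandardized (f : unitInterval → ℝ) : Prop where
  memLp : MemLp f 2 volume
  integral_eq_zero : ∫ x, f x = 0
  integral_sq_eq_one : ∫ x, f x ^ 2 = 1

/-- The maximal correlation coefficient of a copula,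
`sup |∫∫ f(x) g(y) C(dx, dy)|` over all standardized `f`, `g` in `L²([0,1])`. -/
def Copula.maxCorr (C : Copula) : ℝ≥0∞ :=
  ⨆ (f : unitInterval → ℝ) (g : unitInterval → ℝ)
    (_ : IsStandardized f) (_ : IsStandardized g),
    ENNReal.ofReal |∫ z, f z.1 * g z.2 ∂C.law|

/-- The distribution function `x ↦ P(X ≤ x)` of a real random variable, with values in `[0,1]`. -/
def distFun {Ω : Type*} [MeasurableSpace Ω] (P : Measure Ω) [IsProbabilityMeasure P]
    (X : Ω → ℝ) (x : ℝ) : unitInterval :=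
  ⟨P.real {ω | X ω ≤ x}, measureReal_nonneg, measureReal_le_one⟩

/-- `C` is a copula of the random vector `(X, Y)`: the joint distribution function satisfies
`P(X ≤ x, Y ≤ y) = C(F_X(x), F_Y(y))` for all real `x`, `y`. -/
def IsCopulaOf {Ω : Type*} [MeasurableSpace Ω] (C : Copula) (P : Measure Ω)
    [IsProbabilityMeasure P] (X Y : Ω → ℝ) : Prop :=
  ∀ x y : ℝ, P.real {ω | X ω ≤ x ∧ Y ω ≤ y} = C.cdf (distFun P X x) (distFun P Y y)

/-- The σ-field generated by the variables `Y s` with `s ≤ t`. -/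
@[reducible] def pastSigma {Ω : Type*} (Y : ℤ → Ω → ℝ) (t : ℤ) : MeasurableSpace Ω :=
  ⨆ s : ℤ, ⨆ _ : s ≤ t, MeasurableSpace.comap (Y s) inferInstance

/-- The σ-field generated by the variables `Y s` with `t ≤ s`. -/
@[reducible] def futureSigma {Ω : Type*} (Y : ℤ → Ω → ℝ) (t : ℤ) : MeasurableSpace Ω :=
  ⨆ s : ℤ, ⨆ _ : t ≤ s, MeasurableSpace.comap (Y s) inferInstance

/-- `Y` is a real-valued Markov process indexed by `ℤ` (not assumed to be time-homogeneous):
almost surely `P(Y t ∈ A | Y r, r ≤ s) = P(Y t ∈ A | Y s)` for all `s < t` and Borel `A`. -/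
structure IsMarkovProcess {Ω : Type*} [MeasurableSpace Ω] (P : Measure Ω)
    (Y : ℤ → Ω → ℝ) : Prop where
  measurable : ∀ t, Measurable (Y t)
  markov : ∀ s t : ℤ, s < t → ∀ A : Set ℝ, MeasurableSet A →
    P[(Y t ⁻¹' A).indicator (fun _ => (1 : ℝ)) | pastSigma Y s] =ᵐ[P]
      P[(Y t ⁻¹' A).indicator (fun _ => (1 : ℝ)) |
        MeasurableSpace.comap (Y s) inferInstance]

/-- A finite partition of `Ω` (empty cells allowed) into sets of the σ-field `m`. -/
structure IsFinitePartition {Ω : Type*} (m : MeasurableSpace Ω) {I : ℕ}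
    (A : Fin I → Set Ω) : Prop where
  measurableSet : ∀ i, MeasurableSet[m] (A i)
  disjoint : Pairwise (Function.onFun Disjoint A)
  iUnion_eq : ⋃ i, A i = Set.univ

/-- The coefficient of absolute regularity between two σ-fields: the supremum over all finite
partitions of `½ ∑ᵢ ∑ⱼ |P(Aᵢ ∩ Bⱼ) - P(Aᵢ) P(Bⱼ)|`. -/
def betaCoeff {Ω : Type*} [MeasurableSpace Ω] (P : Measure Ω) (m₁ m₂ : MeasurableSpace Ω) :
    ℝ≥0∞ :=
  ⨆ (I : ℕ) (J : ℕ) (A : Fin I → Set Ω) (B : Fin J → Set Ω)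
    (_ : IsFinitePartition m₁ A) (_ : IsFinitePartition m₂ B),
    ENNReal.ofReal (1 / 2 * ∑ i, ∑ j, |P.real (A i ∩ B j) - P.real (A i) * P.real (B j)|)

/-- The `k`-th β-mixing coefficient of a process indexed by `ℤ`. -/
def betaMix {Ω : Type*} [MeasurableSpace Ω] (P : Measure Ω) (Y : ℤ → Ω → ℝ) (k : ℕ) : ℝ≥0∞ :=
  ⨆ t : ℤ, betaCoeff P (pastSigma Y t) (futureSigma Y (t + k))

/-- A process is β-mixing (absolutely regular) if its β-mixing coefficients tend to zero. -/
def IsBetaMixing {Ω : Type*} [MeasurableSpace Ω] (P : Measure Ω) (Y : ℤ → Ω → ℝ) : Prop :=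
  Tendsto (betaMix P Y) atTop (𝓝 0)

end

/-!
The proof reduces the mixing coefficient to operator bounds in `L²` of the one-step transitions.

Let `A i` be a partition in the past of `t`, let `B j` be a partition in the future of `t + 1 + n`,
and put `b j = 1_{B j} - P (B j)`. By the Markov property, used in both time directions
(`condExp_pastSigma_eq`, `condExp_futureSigma_eq`),
`P (A i ∩ B j) - P (A i) P (B j) = E[a i (Y t) * h j (Y (t + 1))]`, where `a i (Y t)` is the
prediction of `1_{A i}` from `Y t` and `h j (Y (t + 1))` is the prediction of `b j` from
`Y (t + 1)`. The quantile transform carries the copula to the law of `(Y t, Y (t + 1))`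
(`IsCopulaOf.map_quantile`; the margins may have atoms), so, the `h j` being centred, this is the
integral of `(c - 1)(u, v)` against `a i (Q u) * h j (Q' v)`, where `Q`, `Q'` are the quantile
functions of `Y t`, `Y (t + 1)`.

Two estimates finish the proof. First, the definition of maximal correlation, applied to a centred
function of `Y (s + 1)` and its prediction from `Y s`, shows that prediction one step back
contracts the `L²` norm by `η`, the supremum of the maximal correlations
(`IsCopulaOf.integral_condExp_sq_le`). Iterating, any combination `∑ s j * h j` with `|s j| ≤ 1`
has norm at most `η ^ n`, since `∑ s j * b j` has norm at most `1`
(`integral_condExp_sq_le_pow`, `IsFinitePartition.integral_sum_sq_le`). Secondly, let `ε i j` be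
the sign of the `(i, j)`-th term. The section at `u` of the function
`∑ ε i j * a i (Q u) * h j (Q' v)` is such a combination, with `s j = ∑ ε i j * a i (Q u)`, as the
`a i` form a partition of unity. Hence this function has `L²` norm at most `η ^ n` on the square,
and the Cauchy–Schwarz inequality bounds the sum of the absolute values of the terms by
`‖c - 1‖₂ * η ^ n` (`sum_abs_integral_mul_le`).
-/

/-! ### Conditional expectations and conditional independence -/

section Conditioning

variable {Ω : Type*} {m₀ : MeasurableSpace Ω} {P : Measure Ω}

theorem integral_indicator_one_mul {B : Set Ω} (hB : MeasurableSet B) (g : Ω → ℝ) :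
    ∫ ω, B.indicator (fun _ => (1 : ℝ)) ω * g ω ∂P = ∫ ω in B, g ω ∂P := by
  rw [← integral_indicator hB]
  congr 1
  ext ω
  by_cases h : ω ∈ B <;> simp [h]

theorem abs_indicator_one_le (B : Set Ω) (ω : Ω) :
    |B.indicator (fun _ => (1 : ℝ)) ω| ≤ 1 := by
  by_cases h : ω ∈ B <;> simp [h]

theorem stronglyMeasurable_indicator_one {m : MeasurableSpace Ω} {B : Set Ω}
    (hB : MeasurableSet[m] B) : StronglyMeasurable[m] (B.indicator fun _ => (1 : ℝ)) :=
  stronglyMeasurable_const.indicator hB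

/-- Two integrable functions with equal integrals over a `π`-system containing the whole space
have equal integrals over the generated σ-field. -/
theorem setIntegral_eq_of_generateFrom {m : MeasurableSpace Ω} (hm : m ≤ m₀)
    {S : Set (Set Ω)} (hS : m = MeasurableSpace.generateFrom S) (hpi : IsPiSystem S)
    (huniv : Set.univ ∈ S) {f g : Ω → ℝ} (hf : Integrable f P) (hg : Integrable g P)
    (h : ∀ B ∈ S, ∫ ω in B, f ω ∂P = ∫ ω in B, g ω ∂P) {B : Set Ω} (hB : MeasurableSet[m] B) :
    ∫ ω in B, f ω ∂P = ∫ ω in B, g ω ∂P := by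
  induction B, hB using MeasurableSpace.induction_on_inter hS hpi with
  | empty => simp
  | basic B hB => exact h B hB
  | compl B hB ih =>
    have hfu := h _ huniv
    simp only [setIntegral_univ] at hfu
    have h1 := integral_add_compl (hm _ hB) hf
    have h2 := integral_add_compl (hm _ hB) hg
    linarith
  | iUnion B hd hB ih =>
    rw [integral_iUnion (fun i => hm _ (hB i)) hd hf.integrableOn,
      integral_iUnion (fun i => hm _ (hB i)) hd hg.integrableOn]
    exact tsum_congr ih

variable [IsProbabilityMeasure P]

theorem integrable_indicator_one {B : Set Ω} (hB : MeasurableSet B) :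
    Integrable (B.indicator fun _ => (1 : ℝ)) P :=
  (integrable_const 1).indicator hB

theorem integrable_of_abs_le {f : Ω → ℝ} (hf : AEStronglyMeasurable f P) {K : ℝ}
    (hK : ∀ᵐ ω ∂P, |f ω| ≤ K) : Integrable f P :=
  Integrable.of_bound hf K hK

/-- The conditional expectation is self-adjoint against bounded `m`-measurable functions. -/
theorem integral_mul_condExp {m : MeasurableSpace Ω} (hm : m ≤ m₀) {f g : Ω → ℝ}
    (hf : StronglyMeasurable[m] f) {K : ℝ} (hK : ∀ᵐ ω ∂P, |f ω| ≤ K) (hg : Integrable g P) :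
    ∫ ω, f ω * (P[g | m]) ω ∂P = ∫ ω, f ω * g ω ∂P := by
  have h := condExp_stronglyMeasurable_mul_of_bound hm hf hg K hK
  calc ∫ ω, f ω * (P[g | m]) ω ∂P = ∫ ω, (P[f * g | m]) ω ∂P :=
        integral_congr_ae (h.mono fun ω hω => by simpa using hω.symm)
    _ = ∫ ω, f ω * g ω ∂P := integral_condExp hm

/-- Conditional independence is symmetric: if conditioning the events of `m₁` on `m₂` is the same
as conditioning them on a common sub-σ-field `m'`, then conditioning bounded `m₂`-measurable
functions on `m₁` is the same as conditioning them on `m'`. -/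
theorem condExp_eq_condExp_of_symm {m' m₁ m₂ : MeasurableSpace Ω} (h1' : m' ≤ m₁)
    (h1 : m₁ ≤ m₀) (h2 : m₂ ≤ m₀)
    (h : ∀ A, MeasurableSet[m₁] A →
      P[A.indicator (fun _ => (1 : ℝ)) | m₂] =ᵐ[P] P[A.indicator (fun _ => (1 : ℝ)) | m'])
    {Z : Ω → ℝ} (hZ : StronglyMeasurable[m₂] Z) {K : ℝ} (hK : ∀ᵐ ω ∂P, |Z ω| ≤ K) :
    P[Z | m₁] =ᵐ[P] P[Z | m'] := by
  have hm' : m' ≤ m₀ := h1'.trans h1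
  have hZi : Integrable Z P := integrable_of_abs_le (hZ.mono h2).aestronglyMeasurable hK
  symm
  refine ae_eq_condExp_of_forall_setIntegral_eq h1 hZi
    (fun _ _ _ => integrable_condExp.integrableOn) (fun A hA _ => ?_)
    (stronglyMeasurable_condExp.mono h1').aestronglyMeasurable
  have hAi : Integrable (A.indicator fun _ => (1 : ℝ)) P := integrable_indicator_one (h1 _ hA)
  rw [← integral_indicator_one_mul (h1 _ hA), ← integral_indicator_one_mul (h1 _ hA)]
  set a : Ω → ℝ := A.indicator fun _ => (1 : ℝ)
  calc ∫ ω, a ω * (P[Z | m']) ω ∂P = ∫ ω, (P[Z | m']) ω * a ω ∂P := by simp_rw [mul_comm]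
    _ = ∫ ω, (P[Z | m']) ω * (P[a | m']) ω ∂P :=
        (integral_mul_condExp hm' stronglyMeasurable_condExp
          (ae_bdd_abs_condExp_of_ae_bdd_abs hK) hAi).symm
    _ = ∫ ω, (P[a | m']) ω * (P[Z | m']) ω ∂P := by simp_rw [mul_comm]
    _ = ∫ ω, (P[a | m']) ω * Z ω ∂P :=
        integral_mul_condExp hm' stronglyMeasurable_condExp
          (ae_bdd_abs_condExp_of_ae_bdd_abs (ae_of_all _ (abs_indicator_one_le A))) hZi
    _ = ∫ ω, Z ω * (P[a | m₂]) ω ∂P :=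
        integral_congr_ae ((h A hA).mono fun ω hω => by simp only; rw [hω, mul_comm])
    _ = ∫ ω, Z ω * a ω ∂P := integral_mul_condExp h2 hZ hK hAi
    _ = ∫ ω, a ω * Z ω ∂P := by simp_rw [mul_comm]

end Conditioning

/-! ### The Markov property for the whole past and the whole future -/

section Markov

variable {Ω : Type*} {Y : ℤ → Ω → ℝ}

theorem comap_le_pastSigma {s t : ℤ} (h : s ≤ t) :
    MeasurableSpace.comap (Y s) inferInstance ≤ pastSigma Y t :=
  le_iSup₂_of_le s h le_rfl

theorem comap_le_futureSigma {s t : ℤ} (h : s ≤ t) :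
    MeasurableSpace.comap (Y t) inferInstance ≤ futureSigma Y s :=
  le_iSup₂_of_le t h le_rfl

theorem pastSigma_mono {s t : ℤ} (h : s ≤ t) : pastSigma Y s ≤ pastSigma Y t :=
  iSup₂_le fun _ hr => comap_le_pastSigma (hr.trans h)

theorem futureSigma_anti {s t : ℤ} (h : s ≤ t) : futureSigma Y t ≤ futureSigma Y s :=
  iSup₂_le fun _ hr => comap_le_futureSigma (h.trans hr)

/-- The σ-field generated by `Y s, …, Y (s + n)`. -/
@[reducible] def windowSigma (Y : ℤ → Ω → ℝ) (s : ℤ) : ℕ → MeasurableSpace Ω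
  | 0 => MeasurableSpace.comap (Y s) inferInstance
  | n + 1 => windowSigma Y s n ⊔ MeasurableSpace.comap (Y (s + n + 1)) inferInstance

theorem comap_le_windowSigma (s : ℤ) (n : ℕ) :
    MeasurableSpace.comap (Y (s + n)) inferInstance ≤ windowSigma Y s n := by
  cases n with
  | zero => simp
  | succ n => 
    have : s + ((n + 1 : ℕ) : ℤ) = s + n + 1 := by push_cast; ring
    rw [this]
    exact le_sup_right

theorem windowSigma_mono (s : ℤ) : Monotone (windowSigma Y s) :=
  monotone_nat_of_le_succ fun _ => le_sup_left

theorem windowSigma_le_pastSigma (s : ℤ) (n : ℕ) : windowSigma Y s n ≤ pastSigma Y (s + n) := by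
  induction n with
  | zero => exact comap_le_pastSigma (by simp)
  | succ n ih =>
    exact sup_le (ih.trans (pastSigma_mono (by push_cast; linarith)))
      (comap_le_pastSigma (by push_cast; linarith))

theorem iSup_windowSigma (s : ℤ) : ⨆ n, windowSigma Y s n = futureSigma Y s := by
  refine le_antisymm (iSup_le fun n => ?_) (iSup₂_le fun r hr => ?_)
  · induction n with
    | zero => exact comap_le_futureSigma le_rfl
    | succ n ih => exact sup_le ih (comap_le_futureSigma (by linarith))
  · obtain ⟨n, rfl⟩ := Int.le.dest hr
    exact (comap_le_windowSigma s n).trans (le_iSup (windowSigma Y s) n)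

variable [mΩ : MeasurableSpace Ω]

theorem pastSigma_le (hY : ∀ t, Measurable (Y t)) (t : ℤ) : pastSigma Y t ≤ mΩ :=
  iSup₂_le fun r _ => (hY r).comap_le

theorem futureSigma_le (hY : ∀ t, Measurable (Y t)) (t : ℤ) : futureSigma Y t ≤ mΩ :=
  iSup₂_le fun r _ => (hY r).comap_le

variable {P : Measure Ω} [IsProbabilityMeasure P]

/-- Given finitely many variables from time `s` on, an event of the past of `s` depends only on
`Y s`. The one-step Markov property enters through the extension of the window by one variable. -/
theorem condExp_window_eq (hY : IsMarkovProcess P Y) {s : ℤ} {A : Set Ω}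
    (hA : MeasurableSet[pastSigma Y s] A) (n : ℕ) :
    P[A.indicator (fun _ => (1 : ℝ)) | windowSigma Y s n] =ᵐ[P]
      P[A.indicator (fun _ => (1 : ℝ)) | MeasurableSpace.comap (Y s) inferInstance] := by
  induction n with
  | zero => rfl
  | succ n ih =>
    have hpast := pastSigma_le hY.measurable
    have hw : ∀ k, windowSigma Y s k ≤ mΩ := fun k => (windowSigma_le_pastSigma s k).trans (hpast _)
    have hAm : MeasurableSet A := hpast _ _ hA
    have hAi : Integrable (A.indicator fun _ => (1 : ℝ)) P := integrable_indicator_one hAm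
    symm
    set a : Ω → ℝ := A.indicator fun _ => (1 : ℝ) with ha
    set g : Ω → ℝ := P[a | MeasurableSpace.comap (Y s) inferInstance] with hg
    have hgm : StronglyMeasurable[MeasurableSpace.comap (Y s) inferInstance] g :=
      stronglyMeasurable_condExp
    have hgb : ∀ᵐ ω ∂P, |g ω| ≤ 1 :=
      ae_bdd_abs_condExp_of_ae_bdd_abs (ae_of_all _ (abs_indicator_one_le A))
    refine ae_eq_condExp_of_forall_setIntegral_eq (hw _) hAi
      (fun _ _ _ => integrable_condExp.integrableOn) (fun E hE _ => ?_)
      (hgm.mono ((comap_le_windowSigma (Y := Y) s 0 |>.trans' (by simp)).trans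
        (windowSigma_mono s (Nat.zero_le _)))).aestronglyMeasurable
    -- it suffices to integrate over `B ∩ D`, with `B` in the old window and `D` generated by the
    -- newest variable
    refine setIntegral_eq_of_generateFrom (hw (n + 1))
      (S := {E | ∃ B D, MeasurableSet[windowSigma Y s n] B ∧
        MeasurableSet[MeasurableSpace.comap (Y (s + n + 1)) inferInstance] D ∧ E = B ∩ D})
      ?_ ?_ ⟨_, _, MeasurableSet.univ, MeasurableSet.univ, by simp⟩ integrable_condExp hAi ?_ hE
    · refine le_antisymm (sup_le (fun B hB => ?_) (fun D hD => ?_)) ?_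
      · exact MeasurableSpace.measurableSet_generateFrom
          ⟨B, Set.univ, hB, MeasurableSet.univ, by simp⟩
      · exact MeasurableSpace.measurableSet_generateFrom
          ⟨Set.univ, D, MeasurableSet.univ, hD, by simp⟩
      · refine MeasurableSpace.generateFrom_le ?_
        rintro _ ⟨B, D, hB, hD, rfl⟩
        exact MeasurableSet.inter (le_sup_left (α := MeasurableSpace Ω) _ hB)
          (le_sup_right (α := MeasurableSpace Ω) _ hD)
    · rintro _ ⟨B, D, hB, hD, rfl⟩ _ ⟨B', D', hB', hD', rfl⟩ _
      exact ⟨B ∩ B', D ∩ D', hB.inter hB', hD.inter hD', Set.inter_inter_inter_comm _ _ _ _⟩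
    · rintro _ ⟨B, D, hB, hD, rfl⟩
      have hBm : MeasurableSet B := hw n _ hB
      have hDm : MeasurableSet D := (hY.measurable _).comap_le _ hD
      have hDi : Integrable (D.indicator fun _ => (1 : ℝ)) P := integrable_indicator_one hDm
      have hBp : StronglyMeasurable[pastSigma Y (s + n)] (B.indicator fun _ => (1 : ℝ)) :=
        stronglyMeasurable_indicator_one (windowSigma_le_pastSigma s n _ hB)
      have hsp : pastSigma Y s ≤ pastSigma Y (s + n) := pastSigma_mono (by linarith)
      have hmul : ∀ f : Ω → ℝ, ∫ ω in B ∩ D, f ω ∂P =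
          ∫ ω, B.indicator (fun _ => (1 : ℝ)) ω * f ω * D.indicator (fun _ => (1 : ℝ)) ω ∂P := by
        intro f
        rw [← integral_indicator (hBm.inter hDm)]
        congr 1
        ext ω
        by_cases h1 : ω ∈ B <;> by_cases h2 : ω ∈ D <;> simp [h1, h2]
      rw [hmul, hmul]
      set b : Ω → ℝ := B.indicator fun _ => (1 : ℝ) with hb
      set d : Ω → ℝ := D.indicator fun _ => (1 : ℝ) with hd
      have hbb : ∀ ω, |b ω| ≤ 1 := abs_indicator_one_le B
      set d' : Ω → ℝ := P[d | MeasurableSpace.comap (Y (s + n)) inferInstance] with hd'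
      have hd'b : ∀ᵐ ω ∂P, |d' ω| ≤ 1 :=
        ae_bdd_abs_condExp_of_ae_bdd_abs (ae_of_all _ (abs_indicator_one_le D))
      have hmk : P[d | pastSigma Y (s + n)] =ᵐ[P] d' := by
        obtain ⟨T, hT, hTD⟩ := hD
        have := hY.markov (s + n) (s + n + 1) (by linarith) T hT
        rwa [hTD] at this
      -- the newest variable may be replaced by its prediction from `Y (s + n)`
      have key : ∀ f : Ω → ℝ, StronglyMeasurable[pastSigma Y (s + n)] f →
          (∀ᵐ ω ∂P, |f ω| ≤ 1) → ∫ ω, b ω * f ω * d ω ∂P = ∫ ω, b ω * d' ω * f ω ∂P := by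
        intro f hf hfb
        rw [← integral_mul_condExp (hpast (s + n)) (f := fun ω => b ω * f ω) (K := 1)
          (hBp.mul hf) (hfb.mono fun ω hω => ?_) hDi]
        · exact integral_congr_ae (hmk.mono fun ω hω => by simp only; rw [hω]; ring)
        · rw [abs_mul]; exact mul_le_one₀ (hbb ω) (abs_nonneg _) hω
      rw [key g (hgm.mono (comap_le_pastSigma (by linarith))) hgb,
        key a ((stronglyMeasurable_indicator_one hA).mono hsp)
          (ae_of_all _ (abs_indicator_one_le A)),
        ← integral_mul_condExp (hw n) (f := fun ω => b ω * d' ω) (K := 1)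
          ((stronglyMeasurable_indicator_one hB).mul
            (stronglyMeasurable_condExp.mono (comap_le_windowSigma s n)))
          (hd'b.mono fun ω hω => ?_) hAi]
      · exact integral_congr_ae (ih.mono fun ω hω => by simp only; rw [hω])
      · rw [abs_mul]; exact mul_le_one₀ (hbb ω) (abs_nonneg _) hω

/-- The Markov property read backwards in time: given the future, an event of the past depends
only on the present. -/
theorem condExp_futureSigma_eq (hY : IsMarkovProcess P Y) {s : ℤ} {A : Set Ω}
    (hA : MeasurableSet[pastSigma Y s] A) :
    P[A.indicator (fun _ => (1 : ℝ)) | futureSigma Y s] =ᵐ[P]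
      P[A.indicator (fun _ => (1 : ℝ)) | MeasurableSpace.comap (Y s) inferInstance] := by
  have hAi : Integrable (A.indicator fun _ => (1 : ℝ)) P :=
    integrable_indicator_one (pastSigma_le hY.measurable _ _ hA)
  have hfut := futureSigma_le hY.measurable s
  symm
  refine ae_eq_condExp_of_forall_setIntegral_eq hfut hAi
    (fun _ _ _ => integrable_condExp.integrableOn) (fun E hE _ => ?_)
    (stronglyMeasurable_condExp.mono (comap_le_futureSigma le_rfl)).aestronglyMeasurable
  refine setIntegral_eq_of_generateFrom hfut
    (S := ⋃ n, {B | MeasurableSet[windowSigma Y s n] B}) ?_ ?_ ?_ integrable_condExp hAi ?_ hE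
  · exact (iSup_windowSigma s).symm.trans
      (MeasurableSpace.generateFrom_iUnion_measurableSet (windowSigma Y s)).symm
  · exact isPiSystem_iUnion_of_monotone _
      (fun n => @MeasurableSpace.isPiSystem_measurableSet _ (windowSigma Y s n))
      (fun i j hij B hB => windowSigma_mono s hij _ hB)
  · exact Set.mem_iUnion.2 ⟨0, @MeasurableSet.univ _ (windowSigma Y s 0)⟩
  · intro B hB
    obtain ⟨n, hB⟩ := Set.mem_iUnion.1 hB
    have hw : windowSigma Y s n ≤ mΩ :=
      (windowSigma_le_pastSigma s n).trans (pastSigma_le hY.measurable _)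
    rw [← setIntegral_condExp hw hAi hB]
    exact integral_congr_ae (ae_restrict_of_ae (condExp_window_eq hY hA n).symm)

/-- The Markov property for arbitrary bounded functions of the future. -/
theorem condExp_pastSigma_eq (hY : IsMarkovProcess P Y) {s : ℤ} {Z : Ω → ℝ}
    (hZ : StronglyMeasurable[futureSigma Y s] Z) {K : ℝ} (hK : ∀ᵐ ω ∂P, |Z ω| ≤ K) :
    P[Z | pastSigma Y s] =ᵐ[P] P[Z | MeasurableSpace.comap (Y s) inferInstance] :=
  condExp_eq_condExp_of_symm (comap_le_pastSigma le_rfl)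
    (pastSigma_le hY.measurable s) (futureSigma_le hY.measurable s)
    (fun _ hA => condExp_futureSigma_eq hY hA) hZ hK

/-- For a function of the future of time `t ≥ s`, predicting from `Y t` and then from `Y s` is the
same as predicting from `Y s`. -/
theorem condExp_condExp_of_markov (hY : IsMarkovProcess P Y) {s t : ℤ} (hst : s ≤ t) {Z : Ω → ℝ}
    (hZ : StronglyMeasurable[futureSigma Y t] Z) {K : ℝ} (hK : ∀ᵐ ω ∂P, |Z ω| ≤ K) :
    P[P[Z | MeasurableSpace.comap (Y t) inferInstance] |
        MeasurableSpace.comap (Y s) inferInstance] =ᵐ[P]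
      P[Z | MeasurableSpace.comap (Y s) inferInstance] :=
  (condExp_congr_ae (condExp_pastSigma_eq hY hZ hK).symm).trans
    (condExp_condExp_of_le (comap_le_pastSigma hst) (pastSigma_le hY.measurable t))

end Markov

/-! ### The Cauchy–Schwarz inequality -/

section CauchySchwarz

/-- The Cauchy–Schwarz inequality for square-integrable real functions. -/
theorem integral_mul_le_sqrt_mul_sqrt {α : Type*} {_ : MeasurableSpace α} {μ : Measure α}
    {f g : α → ℝ} (hf : MemLp f 2 μ) (hg : MemLp g 2 μ) :
    ∫ x, f x * g x ∂μ ≤ √(∫ x, f x ^ 2 ∂μ) * √(∫ x, g x ^ 2 ∂μ) := by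
  have h2 : ENNReal.ofReal 2 = 2 := by norm_num
  have h := integral_mul_norm_le_Lp_mul_Lq (μ := μ) (f := f) (g := g) Real.HolderConjugate.two_two
    (by rwa [h2]) (by rwa [h2])
  simp only [Real.rpow_two, ← Real.sqrt_eq_rpow, Real.norm_eq_abs, sq_abs, ← abs_mul] at h
  exact (le_abs_self _).trans ((abs_integral_le_integral_abs).trans h)

theorem ofReal_sqrt_integral_sq {α : Type*} {_ : MeasurableSpace α} {μ : Measure α} {f : α → ℝ}
    (hf : MemLp f 2 μ) : ENNReal.ofReal √(∫ x, f x ^ 2 ∂μ) = eLpNorm f 2 μ := by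
  rw [hf.eLpNorm_eq_integral_rpow_norm two_ne_zero ENNReal.ofNat_ne_top]
  simp [Real.sqrt_eq_rpow]

end CauchySchwarz

/-! ### Quantile functions -/

section Quantile

variable {Ω : Type*} [MeasurableSpace Ω] {P : Measure Ω} [IsProbabilityMeasure P] {X : Ω → ℝ}

/-- The quantile function of `X`, i.e. the generalized inverse of its distribution function. At the
endpoints of the unit interval, where the infimum below need not be meaningful, it takes the
irrelevant value `0`. -/
noncomputable def quantile (P : Measure Ω) [IsProbabilityMeasure P] (X : Ω → ℝ)
    (u : unitInterval) : ℝ :=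
  open Classical in if u ∈ Set.Ioo 0 1 then sInf {x | u ≤ distFun P X x} else 0

theorem coe_distFun (hX : Measurable X) (x : ℝ) :
    (distFun P X x : ℝ) = cdf (P.map X) x := by
  have := Measure.isProbabilityMeasure_map (μ := P) hX.aemeasurable
  rw [cdf_eq_real, map_measureReal_apply hX measurableSet_Iic]
  rfl

/-- The Galois connection between the quantile function and the distribution function. -/
theorem quantile_le_iff (hX : Measurable X) {u : unitInterval} (hu : u ∈ Set.Ioo 0 1) (x : ℝ) :
    quantile P X u ≤ x ↔ u ≤ distFun P X x := by
  have hmono : Monotone (distFun P X) := fun a b hab =>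
    measureReal_mono fun ω hω => le_trans hω hab
  have hu0 : (0 : ℝ) < u := hu.1
  have hu1 : (u : ℝ) < 1 := hu.2
  rw [quantile, if_pos hu]
  constructor
  · intro h
    by_contra! hlt
    -- right-continuity pushes the strict inequality slightly to the right of `x`
    have hlt' : cdf (P.map X) x < (u : ℝ) := by rw [← coe_distFun hX]; exact hlt
    have hr := ((cdf (P.map X)).right_continuous x).mono_left
      (nhdsWithin_mono x Set.Ioi_subset_Ici_self)
    obtain ⟨y, hy, hxy⟩ :=
      ((hr.eventually_lt_const hlt').and self_mem_nhdsWithin).exists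
    have hyu : distFun P X y < u := by
      rw [← Subtype.coe_lt_coe, coe_distFun hX]; exact hy
    have hne : {x | u ≤ distFun P X x}.Nonempty := by
      obtain ⟨z, hz⟩ := ((tendsto_cdf_atTop (P.map X)).eventually_const_lt hu1).exists
      rw [← coe_distFun hX] at hz
      exact ⟨z, hz.le⟩
    have : y ≤ sInf {x | u ≤ distFun P X x} := le_csInf hne fun z hz =>
      (hmono.reflect_lt (hyu.trans_le hz)).le
    exact absurd (this.trans h) (not_le.2 hxy)
  · intro h
    refine csInf_le ?_ h
    obtain ⟨z, hz⟩ := ((tendsto_cdf_atBot (P.map X)).eventually_lt_const hu0).exists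
    rw [← coe_distFun hX] at hz
    exact ⟨z, fun w hw => (hmono.reflect_lt (lt_of_lt_of_le hz hw)).le⟩

theorem measurable_quantile (hX : Measurable X) : Measurable (quantile P X) := by
  refine measurable_of_Iic fun x => ?_
  have : quantile P X ⁻¹' Set.Iic x = (Set.Ioo 0 1 ∩ Set.Iic (distFun P X x)) ∪
      ((Set.Ioo 0 1)ᶜ ∩ {_u | 0 ≤ x}) := by
    ext u
    by_cases hu : u ∈ Set.Ioo 0 1
    · have := quantile_le_iff (P := P) hX hu x
      simp only [Set.mem_preimage, Set.mem_Iic, Set.mem_union, Set.mem_inter_iff, hu, this,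
        Set.mem_compl_iff]
      tauto
    · simp only [Set.mem_preimage, Set.mem_Iic, Set.mem_union, Set.mem_inter_iff, hu,
        Set.mem_compl_iff, Set.mem_ofPred_eq, quantile, if_false]
      tauto
  rw [this]
  exact (measurableSet_Ioo.inter measurableSet_Iic).union
    (measurableSet_Ioo.compl.inter (MeasurableSet.const _))

theorem ae_mem_Ioo_unitInterval : ∀ᵐ u : unitInterval, u ∈ Set.Ioo (0 : unitInterval) 1 := by
  have h0 : ∀ᵐ u : unitInterval, u ≠ 0 := by simp [ae_iff]
  have h1 : ∀ᵐ u : unitInterval, u ≠ 1 := by simp [ae_iff]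
  filter_upwards [h0, h1] with u hu0 hu1
  exact ⟨unitInterval.pos_iff_ne_zero.2 hu0, unitInterval.lt_one_iff_ne_one.2 hu1⟩

theorem map_quantile (hX : Measurable X) :
    (volume : Measure unitInterval).map (quantile P X) = P.map X := by
  have hQ := measurable_quantile (P := P) hX
  have := Measure.isProbabilityMeasure_map (μ := P) hX.aemeasurable
  have := Measure.isProbabilityMeasure_map (μ := (volume : Measure unitInterval)) hQ.aemeasurable
  refine Measure.ext_of_Iic _ _ fun x => ?_
  rw [Measure.map_apply hQ measurableSet_Iic, Measure.map_apply hX measurableSet_Iic]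
  have : quantile P X ⁻¹' Set.Iic x =ᵐ[volume] Set.Iic (distFun P X x) :=
    ae_mem_Ioo_unitInterval.mono fun u hu => propext (quantile_le_iff hX hu x)
  rw [measure_congr this, unitInterval.volume_Iic]
  exact ofReal_measureReal

theorem integral_comp_quantile (hX : Measurable X) {f : ℝ → ℝ} (hf : Measurable f) :
    ∫ u, f (quantile P X u) = ∫ ω, f (X ω) ∂P := by
  rw [← integral_map hX.aemeasurable hf.aestronglyMeasurable, ← map_quantile hX,
    integral_map (measurable_quantile hX).aemeasurable hf.aestronglyMeasurable]

theorem memLp_comp_quantile (hX : Measurable X) {f : ℝ → ℝ} (hf : Measurable f) {p : ℝ≥0∞}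
    (h : MemLp (fun ω => f (X ω)) p P) : MemLp (fun u => f (quantile P X u)) p volume := by
  have h' := (memLp_map_measure_iff hf.aestronglyMeasurable hX.aemeasurable).2 h
  rw [← map_quantile hX] at h'
  exact (memLp_map_measure_iff hf.aestronglyMeasurable (measurable_quantile hX).aemeasurable).1 h'

theorem ae_comp_quantile (hX : Measurable X) {p : ℝ → Prop} (hp : MeasurableSet {x | p x})
    (h : ∀ᵐ ω ∂P, p (X ω)) : ∀ᵐ u, p (quantile P X u) := by
  rw [← ae_map_iff hX.aemeasurable hp, ← map_quantile hX,
    ae_map_iff (measurable_quantile hX).aemeasurable hp] at h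
  exact h

end Quantile

/-! ### Copulas and maximal correlation -/

section Copula

theorem Copula.measurePreserving_fst (C : Copula) : MeasurePreserving Prod.fst C.law volume :=
  ⟨measurable_fst, C.map_fst⟩

theorem Copula.measurePreserving_snd (C : Copula) : MeasurePreserving Prod.snd C.law volume :=
  ⟨measurable_snd, C.map_snd⟩

theorem Copula.isProbabilityMeasure (C : Copula) : IsProbabilityMeasure C.law :=
  ⟨by rw [← Set.preimage_univ (f := Prod.fst), C.measurePreserving_fst.measure_preimage
    MeasurableSet.univ.nullMeasurableSet, measure_univ]⟩

variable {Ω : Type*} [MeasurableSpace Ω] {P : Measure Ω} [IsProbabilityMeasure P] {X Y : Ω → ℝ}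

/-- The quantile transform carries a copula of `(X, Y)` to the law of `(X, Y)`. -/
theorem IsCopulaOf.map_quantile {C : Copula} (hC : IsCopulaOf C P X Y) (hX : Measurable X)
    (hY : Measurable Y) :
    C.law.map (Prod.map (quantile P X) (quantile P Y)) = P.map fun ω => (X ω, Y ω) := by
  have hQ : Measurable (Prod.map (quantile P X) (quantile P Y)) :=
    (measurable_quantile hX).prodMap (measurable_quantile hY)
  have hXY : Measurable fun ω => (X ω, Y ω) := hX.prodMk hY
  have := C.isProbabilityMeasure
  have := Measure.isProbabilityMeasure_map (μ := P) hXY.aemeasurable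
  have := Measure.isProbabilityMeasure_map (μ := C.law) hQ.aemeasurable
  have hspan : IsCountablySpanning (Set.range (Set.Iic : ℝ → Set ℝ)) :=
    ⟨fun n : ℕ => Set.Iic n, fun n => ⟨n, rfl⟩,
      Set.iUnion_eq_univ_iff.2 fun x => exists_nat_ge x⟩
  have hgen : MeasurableSpace.generateFrom (Set.range (Set.Iic : ℝ → Set ℝ)) =
      Real.measurableSpace :=
    (borel_eq_generateFrom_Iic ℝ).symm.trans (BorelSpace.measurable_eq (α := ℝ)).symm
  refine ext_of_generate_finite _ (generateFrom_eq_prod hgen hgen hspan hspan).symm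
    (isPiSystem_Iic.prod isPiSystem_Iic) ?_ (by simp)
  rintro _ ⟨_, ⟨x, rfl⟩, _, ⟨y, rfl⟩, rfl⟩
  have hm : MeasurableSet (Set.Iic x ×ˢ Set.Iic y) := measurableSet_Iic.prod measurableSet_Iic
  rw [Measure.map_apply hQ hm, Measure.map_apply hXY hm]
  have : Prod.map (quantile P X) (quantile P Y) ⁻¹' (Set.Iic x ×ˢ Set.Iic y) =ᵐ[C.law]
      Set.Iic (distFun P X x) ×ˢ Set.Iic (distFun P Y y) := by
    filter_upwards [C.measurePreserving_fst.quasiMeasurePreserving.ae ae_mem_Ioo_unitInterval,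
      C.measurePreserving_snd.quasiMeasurePreserving.ae ae_mem_Ioo_unitInterval] with z h1 h2
    exact propext (and_congr (quantile_le_iff hX h1 x) (quantile_le_iff hY h2 y))
  rw [measure_congr this]
  have h := hC x y
  rw [Copula.cdf] at h
  exact ((measureReal_eq_measureReal_iff).1 h).symm

/-- Expectations of products of functions of `X` and `Y` are integrals over the unit square. -/
theorem IsCopulaOf.integral_mul {C : Copula} (hC : IsCopulaOf C P X Y) (hX : Measurable X)
    (hY : Measurable Y) {f g : ℝ → ℝ} (hf : Measurable f) (hg : Measurable g) :
    ∫ ω, f (X ω) * g (Y ω) ∂P = ∫ z, f (quantile P X z.1) * g (quantile P Y z.2) ∂C.law := by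
  have hQ : Measurable (Prod.map (quantile P X) (quantile P Y)) :=
    (measurable_quantile hX).prodMap (measurable_quantile hY)
  have hm : Measurable fun w : ℝ × ℝ => f w.1 * g w.2 :=
    (hf.comp measurable_fst).mul (hg.comp measurable_snd)
  have h1 := integral_map (μ := P) (hX.prodMk hY).aemeasurable hm.aestronglyMeasurable
  have h2 := integral_map (μ := C.law) hQ.aemeasurable hm.aestronglyMeasurable
  rw [hC.map_quantile hX hY] at h2
  exact h1.symm.trans h2

/-- The maximal correlation bounds the bilinear form of a copula on centred functions. -/
theorem Copula.abs_integral_mul_le (C : Copula) {η : ℝ} (hη : 0 ≤ η)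
    (hC : C.maxCorr ≤ ENNReal.ofReal η) {f g : unitInterval → ℝ} (hf : MemLp f 2 volume)
    (hg : MemLp g 2 volume) (hf0 : ∫ x, f x = 0) (hg0 : ∫ x, g x = 0) :
    |∫ z, f z.1 * g z.2 ∂C.law| ≤ η * (√(∫ x, f x ^ 2) * √(∫ x, g x ^ 2)) := by
  -- `f` and `g` can be normalized to unit norm unless they vanish almost everywhere
  have hzero : ∀ h : unitInterval → ℝ, MemLp h 2 volume → √(∫ x, h x ^ 2) = 0 →
      ∀ᵐ x, h x = 0 := by
    intro h hh h0
    rw [Real.sqrt_eq_zero (integral_nonneg fun _ => sq_nonneg _),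
      integral_eq_zero_iff_of_nonneg (fun _ => sq_nonneg _) hh.integrable_sq] at h0
    exact h0.mono fun x hx => by simpa using hx
  have hstd : ∀ h : unitInterval → ℝ, MemLp h 2 volume → ∫ x, h x = 0 →
      √(∫ x, h x ^ 2) ≠ 0 → IsStandardized fun x => (√(∫ x, h x ^ 2))⁻¹ * h x := by
    intro h hh h0 hne
    refine ⟨hh.const_mul _, by rw [integral_const_mul, h0, mul_zero], ?_⟩
    simp_rw [mul_pow]
    rw [integral_const_mul, inv_pow, Real.sq_sqrt (integral_nonneg fun _ => sq_nonneg _)]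
    refine inv_mul_cancel₀ fun h => hne (by rw [h, Real.sqrt_zero])
  simp only [Copula.maxCorr, iSup_le_iff] at hC
  set r := √(∫ x, f x ^ 2) with hr
  set s := √(∫ x, g x ^ 2) with hs
  have hr0 : 0 ≤ r := Real.sqrt_nonneg _
  have hs0 : 0 ≤ s := Real.sqrt_nonneg _
  rcases eq_or_ne r 0 with h | hrne
  · have h1 := C.measurePreserving_fst.quasiMeasurePreserving.ae (hzero f hf h)
    rw [integral_eq_zero_of_ae (h1.mono fun z hz => by simp [hz])]
    simp only [abs_zero]; positivity
  rcases eq_or_ne s 0 with h | hsne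
  · have h1 := C.measurePreserving_snd.quasiMeasurePreserving.ae (hzero g hg h)
    rw [integral_eq_zero_of_ae (h1.mono fun z hz => by simp [hz])]
    simp only [abs_zero]; positivity
  have h1 : ENNReal.ofReal |∫ z, (r⁻¹ * f z.1) * (s⁻¹ * g z.2) ∂C.law| ≤ ENNReal.ofReal η :=
    hC _ _ (hstd f hf hf0 hrne) (hstd g hg hg0 hsne)
  rw [ENNReal.ofReal_le_ofReal_iff hη] at h1
  have h2 : ∫ z, (r⁻¹ * f z.1) * (s⁻¹ * g z.2) ∂C.law
      = (r * s)⁻¹ * ∫ z, f z.1 * g z.2 ∂C.law := by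
    rw [← integral_const_mul]
    congr 1; ext z; rw [mul_inv]; ring
  have hpos : 0 < r * s := by positivity
  rwa [h2, abs_mul, abs_inv, abs_of_pos hpos, inv_mul_le_iff₀ hpos, mul_comm] at h1

/-- Prediction of a centred function of `Y` from `X` contracts the `L²` norm by the maximal
correlation of a copula of `(X, Y)`. -/
theorem IsCopulaOf.integral_condExp_sq_le {C : Copula} (hC : IsCopulaOf C P X Y)
    (hX : Measurable X) (hY : Measurable Y) {η : ℝ} (hη : 0 ≤ η)
    (hCη : C.maxCorr ≤ ENNReal.ofReal η) {W : Ω → ℝ}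
    (hW : StronglyMeasurable[MeasurableSpace.comap Y inferInstance] W) {K : ℝ}
    (hK : ∀ᵐ ω ∂P, |W ω| ≤ K) (hW0 : ∫ ω, W ω ∂P = 0) :
    ∫ ω, (P[W | MeasurableSpace.comap X inferInstance]) ω ^ 2 ∂P ≤ η ^ 2 * ∫ ω, W ω ^ 2 ∂P := by
  have hWm := (hW.mono hY.comap_le).aestronglyMeasurable (μ := P)
  have hWi : Integrable W P := integrable_of_abs_le hWm hK
  set V : Ω → ℝ := P[W | MeasurableSpace.comap X inferInstance] with hV
  have hVm : StronglyMeasurable[MeasurableSpace.comap X inferInstance] V :=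
    stronglyMeasurable_condExp
  have hVK : ∀ᵐ ω ∂P, |V ω| ≤ K := ae_bdd_abs_condExp_of_ae_bdd_abs hK
  have hV2 : MemLp V 2 P := MemLp.of_bound (hVm.mono hX.comap_le).aestronglyMeasurable K hVK
  have hW2 : MemLp W 2 P := MemLp.of_bound hWm K hK
  have hV0 : ∫ ω, V ω ∂P = 0 := (integral_condExp hX.comap_le).trans hW0
  have hVW : ∫ ω, V ω ^ 2 ∂P = ∫ ω, V ω * W ω ∂P := by
    rw [← integral_mul_condExp hX.comap_le hVm hVK hWi]
    simp_rw [pow_two]; rfl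
  obtain ⟨f, hf, hfV⟩ := hVm.measurable.exists_eq_measurable_comp
  obtain ⟨g, hg, hgW⟩ := hW.measurable.exists_eq_measurable_comp
  clear_value V
  subst hfV hgW
  simp only [Function.comp_def] at *
  have h := C.abs_integral_mul_le hη hCη (memLp_comp_quantile hX hf hV2)
    (memLp_comp_quantile hY hg hW2) ((integral_comp_quantile hX hf).trans hV0)
    ((integral_comp_quantile hY hg).trans hW0)
  rw [← hC.integral_mul hX hY hf hg, integral_comp_quantile (f := fun x => f x ^ 2) hX
    (hf.pow_const 2), integral_comp_quantile (f := fun x => g x ^ 2) hY (hg.pow_const 2),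
    ← hVW] at h
  have hv : 0 ≤ ∫ ω, f (X ω) ^ 2 ∂P := integral_nonneg fun _ => sq_nonneg _
  have hw : 0 ≤ ∫ ω, g (Y ω) ^ 2 ∂P := integral_nonneg fun _ => sq_nonneg _
  rw [abs_of_nonneg hv] at h
  set v := √(∫ ω, f (X ω) ^ 2 ∂P) with hvdef
  set w := √(∫ ω, g (Y ω) ^ 2 ∂P) with hwdef
  have hvs : v ^ 2 = ∫ ω, f (X ω) ^ 2 ∂P := Real.sq_sqrt hv
  have hws : w ^ 2 = ∫ ω, g (Y ω) ^ 2 ∂P := Real.sq_sqrt hw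
  have hv0 : 0 ≤ v := Real.sqrt_nonneg _
  have hw0 : 0 ≤ w := Real.sqrt_nonneg _
  rw [← hvs] at h ⊢
  rw [← hws, ← mul_pow]
  refine pow_le_pow_left₀ hv0 ?_ 2
  rcases hv0.eq_or_lt with h0 | h0
  · rw [← h0]; positivity
  · nlinarith

end Copula

/-! ### Integral kernels and partitions of unity -/

section Kernel

theorem memLp_mul_prod_of_abs_le_one {α β : Type*} [MeasurableSpace α] [MeasurableSpace β]
    {μ : Measure α} {ν : Measure β} [IsProbabilityMeasure μ] [IsProbabilityMeasure ν] {p : ℝ≥0∞}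
    {a : α → ℝ} {h : β → ℝ} (ha : Measurable a) (hh : Measurable h) (ha1 : ∀ᵐ x ∂μ, |a x| ≤ 1)
    (hh1 : ∀ᵐ y ∂ν, |h y| ≤ 1) : MemLp (fun z : α × β => a z.1 * h z.2) p (μ.prod ν) := by
  refine MemLp.of_bound ((ha.comp measurable_fst).mul
    (hh.comp measurable_snd)).aestronglyMeasurable 1 ?_
  filter_upwards [Measure.quasiMeasurePreserving_fst.ae ha1,
    Measure.quasiMeasurePreserving_snd.ae hh1] with z h1 h2
  rw [Real.norm_eq_abs, abs_mul]
  exact mul_le_one₀ h1 (abs_nonneg _) h2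

/-- The step that turns a bound for single functions into a bound for partitions. If `a` is a
subpartition of unity on `α` and all combinations of the `h j` with coefficients in `[-1, 1]` have
`L²` norm at most `ρ`, then the absolute integrals of the `a i ⊗ h j` against `w` sum to at most
`ρ ‖w‖₂`. Indeed, with `ε i j` the sign of the `(i, j)`-th integral, each section at `x` of
`∑ ε i j • a i ⊗ h j` is the combination of the `h j` with coefficients `∑ i, ε i j * a i x`. -/
theorem sum_abs_integral_mul_le {α β ι κ : Type*} [Fintype ι] [Fintype κ] [MeasurableSpace α]
    [MeasurableSpace β] {μ : Measure α} {ν : Measure β} [IsProbabilityMeasure μ]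
    [IsProbabilityMeasure ν] {w : α × β → ℝ} (hw : MemLp w 2 (μ.prod ν)) {a : ι → α → ℝ}
    {h : κ → β → ℝ} (ha : ∀ i, Measurable (a i)) (hh : ∀ j, Measurable (h j))
    (ha0 : ∀ᵐ x ∂μ, ∀ i, 0 ≤ a i x) (ha1 : ∀ᵐ x ∂μ, ∑ i, a i x ≤ 1)
    (hh1 : ∀ j, ∀ᵐ y ∂ν, |h j y| ≤ 1) {ρ : ℝ} (hρ : 0 ≤ ρ)
    (hs : ∀ s : κ → ℝ, (∀ j, |s j| ≤ 1) → ∫ y, (∑ j, s j * h j y) ^ 2 ∂ν ≤ ρ ^ 2) :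
    ∑ i, ∑ j, |∫ z, w z * (a i z.1 * h j z.2) ∂μ.prod ν| ≤ √(∫ z, w z ^ 2 ∂μ.prod ν) * ρ := by
  have hF : ∀ i j, MemLp (fun z : α × β => a i z.1 * h j z.2) 2 (μ.prod ν) := by
    intro i j
    refine memLp_mul_prod_of_abs_le_one (ha i) (hh j) ?_ (hh1 j)
    filter_upwards [ha0, ha1] with x h0 h1
    rw [abs_of_nonneg (h0 i)]
    exact (Finset.single_le_sum (fun i _ => h0 i) (Finset.mem_univ i)).trans h1
  set ε : ι → κ → ℝ := fun i j =>
    ((SignType.sign (∫ z, w z * (a i z.1 * h j z.2) ∂μ.prod ν) : SignType) : ℝ) with hε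
  have hε1 : ∀ i j, |ε i j| ≤ 1 := by
    intro i j
    simp only [hε]
    cases SignType.sign (∫ z, w z * (a i z.1 * h j z.2) ∂μ.prod ν) <;> simp
  set F : α × β → ℝ := fun z => ∑ i, ∑ j, ε i j * (a i z.1 * h j z.2) with hFdef
  have hF2 : MemLp F 2 (μ.prod ν) :=
    memLp_finsetSum _ fun i _ => memLp_finsetSum _ fun j _ => (hF i j).const_mul _
  have hint : ∀ i j, Integrable (fun z => ε i j * (w z * (a i z.1 * h j z.2))) (μ.prod ν) :=
    fun i j => (hw.integrable_mul (hF i j)).const_mul _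
  have hsum : ∑ i, ∑ j, |∫ z, w z * (a i z.1 * h j z.2) ∂μ.prod ν| =
      ∫ z, w z * F z ∂μ.prod ν := by
    have : ∀ z, w z * F z = ∑ i, ∑ j, ε i j * (w z * (a i z.1 * h j z.2)) := by
      intro z
      simp only [hFdef, Finset.mul_sum]
      exact Finset.sum_congr rfl fun i _ => Finset.sum_congr rfl fun j _ => by ring
    simp_rw [this]
    rw [integral_finsetSum _ fun i _ => integrable_finsetSum _ fun j _ => hint i j]
    refine Finset.sum_congr rfl fun i _ => ?_
    rw [integral_finsetSum _ fun j _ => hint i j]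
    refine Finset.sum_congr rfl fun j _ => ?_
    rw [integral_const_mul]
    exact (sign_mul_self _).symm
  rw [hsum]
  refine (integral_mul_le_sqrt_mul_sqrt hw hF2).trans ?_
  refine mul_le_mul_of_nonneg_left (Real.sqrt_le_iff.2 ⟨hρ, ?_⟩) (Real.sqrt_nonneg _)
  rw [integral_prod _ hF2.integrable_sq]
  calc ∫ x, ∫ y, F (x, y) ^ 2 ∂ν ∂μ ≤ ∫ _x, ρ ^ 2 ∂μ := by
        refine integral_mono_ae hF2.integrable_sq.integral_prod_left (integrable_const _) ?_
        filter_upwards [ha0, ha1] with x h0 h1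
        have hFx : ∀ y, F (x, y) = ∑ j, (∑ i, ε i j * a i x) * h j y := by
          intro y
          simp only [hFdef, Finset.sum_mul]
          rw [Finset.sum_comm]
          exact Finset.sum_congr rfl fun j _ => Finset.sum_congr rfl fun i _ => by ring
        simp_rw [hFx]
        refine hs _ fun j => (Finset.abs_sum_le_sum_abs _ _).trans (le_trans ?_ h1)
        refine Finset.sum_le_sum fun i _ => ?_
        rw [abs_mul, abs_of_nonneg (h0 i)]
        exact mul_le_of_le_one_left (h0 i) (hε1 i j)
    _ = ρ ^ 2 := by simp

end Kernel

/-! ### Decay of dependence along the process -/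

section Decay

theorem IsFinitePartition.sum_indicator {Ω : Type*} {m : MeasurableSpace Ω} {I : ℕ}
    {A : Fin I → Set Ω} (hA : IsFinitePartition m A) (ω : Ω) :
    ∑ i, (A i).indicator (fun _ => (1 : ℝ)) ω = 1 := by
  obtain ⟨i, hi⟩ := Set.iUnion_eq_univ_iff.1 hA.iUnion_eq ω
  rw [Finset.sum_eq_single i (fun j _ hj => Set.indicator_of_notMem
    (fun hωj => Set.disjoint_left.1 (hA.disjoint hj) hωj hi) _) (by simp),
    Set.indicator_of_mem hi]

variable {Ω : Type*} [mΩ : MeasurableSpace Ω] {P : Measure Ω} [IsProbabilityMeasure P]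
  {Y : ℤ → Ω → ℝ}

theorem integral_condExp_sq_le_integral_sq {m : MeasurableSpace Ω} (hm : m ≤ mΩ) {Z : Ω → ℝ}
    (hZ : AEStronglyMeasurable[mΩ] Z P) {K : ℝ} (hK : ∀ᵐ ω ∂P, |Z ω| ≤ K) :
    ∫ ω, (P[Z | m]) ω ^ 2 ∂P ≤ ∫ ω, Z ω ^ 2 ∂P := by
  have hZ2 : MemLp Z 2 P := MemLp.of_bound hZ K hK
  have hV2 : MemLp (P[Z | m]) 2 P := MemLp.of_bound
    (stronglyMeasurable_condExp.mono hm).aestronglyMeasurable K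
    (ae_bdd_abs_condExp_of_ae_bdd_abs hK)
  have h := integral_mul_condExp (P := P) hm stronglyMeasurable_condExp
    (ae_bdd_abs_condExp_of_ae_bdd_abs hK) (hZ2.integrable one_le_two)
  have hCS := integral_mul_le_sqrt_mul_sqrt hV2 hZ2
  rw [← h] at hCS
  simp_rw [← pow_two] at hCS
  have h1 : 0 ≤ ∫ ω, (P[Z | m]) ω ^ 2 ∂P := integral_nonneg fun _ => sq_nonneg _
  have h2 : 0 ≤ ∫ ω, Z ω ^ 2 ∂P := integral_nonneg fun _ => sq_nonneg _
  nlinarith [Real.sq_sqrt h1, Real.sq_sqrt h2,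
    sq_nonneg (√(∫ ω, (P[Z | m]) ω ^ 2 ∂P) - √(∫ ω, Z ω ^ 2 ∂P))]

/-- Predicting a centred function of the future of time `r` from `n` steps earlier loses a factor
`η` of the `L²` norm per step. -/
theorem integral_condExp_sq_le_pow (hY : IsMarkovProcess P Y) {C : ℤ → Copula}
    (hC : ∀ t, IsCopulaOf (C t) P (Y t) (Y (t + 1))) {η : ℝ} (hη : 0 ≤ η)
    (hCη : ∀ t, (C t).maxCorr ≤ ENNReal.ofReal η) {r : ℤ} {Z : Ω → ℝ}
    (hZ : StronglyMeasurable[futureSigma Y r] Z) {K : ℝ} (hK : ∀ᵐ ω ∂P, |Z ω| ≤ K)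
    (hZ0 : ∫ ω, Z ω ∂P = 0) (n : ℕ) :
    ∀ s : ℤ, s + n = r → ∫ ω, (P[Z | MeasurableSpace.comap (Y s) inferInstance]) ω ^ 2 ∂P ≤
      (η ^ n) ^ 2 * ∫ ω, Z ω ^ 2 ∂P := by
  have hZm := (hZ.mono (futureSigma_le hY.measurable r)).aestronglyMeasurable (μ := P)
  induction n with
  | zero =>
    intro s _
    simpa using integral_condExp_sq_le_integral_sq (hY.measurable s).comap_le hZm hK
  | succ n ih =>
    intro s hs
    have ih' := ih (s + 1) (by rw [← hs]; push_cast; ring)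
    have hsr : s + 1 ≤ r := by rw [← hs]; push_cast; linarith
    have htower := condExp_condExp_of_markov hY (le_add_of_nonneg_right zero_le_one : s ≤ s + 1)
      (hZ.mono (futureSigma_anti hsr)) hK
    have hstep := (hC s).integral_condExp_sq_le (hY.measurable s) (hY.measurable (s + 1)) hη (hCη s)
      (W := P[Z | MeasurableSpace.comap (Y (s + 1)) inferInstance]) stronglyMeasurable_condExp
      (ae_bdd_abs_condExp_of_ae_bdd_abs hK)
      ((integral_condExp (hY.measurable (s + 1)).comap_le).trans hZ0)
    calc _ = _ := integral_congr_ae (htower.mono fun ω hω => congrArg (· ^ 2) hω.symm)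
      _ ≤ _ := hstep
      _ ≤ η ^ 2 * ((η ^ n) ^ 2 * ∫ ω, Z ω ^ 2 ∂P) := mul_le_mul_of_nonneg_left ih' (sq_nonneg η)
      _ = _ := by ring

/-- By the Markov property, past events at time `t` and functions of the future of `t + 1` interact
only through their predictions from `Y t` and `Y (t + 1)`. -/
theorem integral_indicator_mul_eq (hY : IsMarkovProcess P Y) {t : ℤ} {A : Set Ω}
    (hA : MeasurableSet[pastSigma Y t] A) {Z : Ω → ℝ}
    (hZ : StronglyMeasurable[futureSigma Y (t + 1)] Z) {K : ℝ} (hK : ∀ᵐ ω ∂P, |Z ω| ≤ K) :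
    ∫ ω, A.indicator (fun _ => (1 : ℝ)) ω * Z ω ∂P =
      ∫ ω, (P[A.indicator (fun _ => (1 : ℝ)) | MeasurableSpace.comap (Y t) inferInstance]) ω *
        (P[Z | MeasurableSpace.comap (Y (t + 1)) inferInstance]) ω ∂P := by
  have ht : t ≤ t + 1 := le_add_of_nonneg_right zero_le_one
  have hZi : Integrable Z P := integrable_of_abs_le
    (hZ.mono (futureSigma_le hY.measurable _)).aestronglyMeasurable hK
  have hAi : Integrable (A.indicator fun _ => (1 : ℝ)) P :=
    integrable_indicator_one (pastSigma_le hY.measurable _ _ hA)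
  rw [← integral_mul_condExp (pastSigma_le hY.measurable (t + 1))
    (stronglyMeasurable_indicator_one (pastSigma_mono ht _ hA))
    (ae_of_all _ (abs_indicator_one_le A)) hZi]
  have hfut := integral_mul_condExp (P := P) (futureSigma_le hY.measurable t)
    (stronglyMeasurable_condExp.mono (comap_le_futureSigma ht))
    (ae_bdd_abs_condExp_of_ae_bdd_abs hK :
      ∀ᵐ ω ∂P, |(P[Z | MeasurableSpace.comap (Y (t + 1)) inferInstance]) ω| ≤ K) hAi
  calc _ = ∫ ω, (P[Z | MeasurableSpace.comap (Y (t + 1)) inferInstance]) ω *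
          A.indicator (fun _ => (1 : ℝ)) ω ∂P :=
        integral_congr_ae ((condExp_pastSigma_eq hY hZ hK).mono fun ω hω => by
          simp only; rw [hω, mul_comm])
    _ = _ := hfut.symm
    _ = _ := integral_congr_ae ((condExp_futureSigma_eq hY hA).mono fun ω hω => by
          simp only; rw [hω, mul_comm])

theorem integral_law_eq {C : Copula} {c : unitInterval × unitInterval → ℝ} (hc : C.HasDensity c)
    (F : unitInterval × unitInterval → ℝ) : ∫ z, F z ∂C.law = ∫ z, c z * F z := by
  rw [hc.law_eq, integral_withDensity_eq_integral_toReal_smul₀ hc.aemeasurable.ennreal_ofReal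
    (ae_of_all _ fun _ => ENNReal.ofReal_lt_top)]
  exact integral_congr_ae (hc.nonneg.mono fun z hz => by
    simp only; rw [ENNReal.toReal_ofReal hz, smul_eq_mul])

/-- Linear combinations, with coefficients in `[-1, 1]`, of the centred indicators of a partition
have `L²` norm at most one. -/
theorem IsFinitePartition.integral_sum_sq_le {m : MeasurableSpace Ω} (hm : m ≤ mΩ) {J : ℕ}
    {B : Fin J → Set Ω} (hB : IsFinitePartition m B) {s : Fin J → ℝ} (hs : ∀ j, |s j| ≤ 1) :
    ∫ ω, (∑ j, s j * ((B j).indicator (fun _ => (1 : ℝ)) ω - P.real (B j))) ^ 2 ∂P ≤ 1 := by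
  set S : Ω → ℝ := fun ω => ∑ j, s j * (B j).indicator (fun _ => (1 : ℝ)) ω with hS
  have hSm : StronglyMeasurable[mΩ] S := Finset.stronglyMeasurable_fun_sum _ fun j _ =>
    (stronglyMeasurable_indicator_one (hm _ (hB.measurableSet j))).const_mul _
  have hS1 : ∀ ω, |S ω| ≤ 1 := by
    intro ω
    rw [← hB.sum_indicator ω]
    refine (Finset.abs_sum_le_sum_abs _ _).trans (Finset.sum_le_sum fun j _ => ?_)
    have h0 : 0 ≤ (B j).indicator (fun _ => (1 : ℝ)) ω :=
      Set.indicator_nonneg (fun _ _ => zero_le_one) ω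
    rw [abs_mul, abs_of_nonneg h0]
    exact mul_le_of_le_one_left h0 (hs j)
  have hSint : ∫ ω, S ω ∂P = ∑ j, s j * P.real (B j) := by
    rw [hS, integral_finsetSum _ fun j _ =>
      (integrable_indicator_one (hm _ (hB.measurableSet j))).const_mul _]
    refine Finset.sum_congr rfl fun j _ => ?_
    rw [integral_const_mul, integral_indicator_const _ (hm _ (hB.measurableSet j)), smul_eq_mul,
      mul_one]
  -- the sum is a centred variable bounded by one, whose variance is at most one
  have heq : ∀ ω, ∑ j, s j * ((B j).indicator (fun _ => (1 : ℝ)) ω - P.real (B j)) =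
      S ω - ∫ ω, S ω ∂P := by
    intro ω
    rw [hSint, hS, ← Finset.sum_sub_distrib]
    exact Finset.sum_congr rfl fun j _ => by ring
  simp_rw [heq]
  rw [← variance_eq_integral hSm.measurable.aemeasurable]
  refine (variance_le_expectation_sq hSm.aestronglyMeasurable).trans ?_
  have hSq : Integrable (S ^ 2) P :=
    (MemLp.of_bound hSm.aestronglyMeasurable 1 (ae_of_all _ hS1)).integrable_sq
  calc ∫ ω, (S ^ 2) ω ∂P ≤ ∫ _ω, (1 : ℝ) ∂P :=
        integral_mono hSq (integrable_const _) fun ω => by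
          simpa using hS1 ω
    _ = 1 := by simp

/-- The bound for a single pair of partitions, `n + 1` time steps apart. -/
theorem sum_abs_measureReal_inter_sub_le (hY : IsMarkovProcess P Y) {C : ℤ → Copula}
    (hC : ∀ t, IsCopulaOf (C t) P (Y t) (Y (t + 1))) {η : ℝ} (hη : 0 ≤ η)
    (hCη : ∀ t, (C t).maxCorr ≤ ENNReal.ofReal η) {t : ℤ} {c : unitInterval × unitInterval → ℝ}
    (hc : (C t).HasDensity c) (hc2 : MemLp c 2 volume) (n : ℕ) {I J : ℕ} {A : Fin I → Set Ω}
    {B : Fin J → Set Ω} (hA : IsFinitePartition (pastSigma Y t) A)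
    (hB : IsFinitePartition (futureSigma Y (t + 1 + n)) B) :
    ∑ i, ∑ j, |P.real (A i ∩ B j) - P.real (A i) * P.real (B j)| ≤
      √(∫ z, (c z - 1) ^ 2) * η ^ n := by
  have hX := hY.measurable t
  have hX' := hY.measurable (t + 1)
  have hAm : ∀ i, MeasurableSet (A i) :=
    fun i => pastSigma_le hY.measurable _ _ (hA.measurableSet i)
  have hBm : ∀ j, MeasurableSet (B j) :=
    fun j => futureSigma_le hY.measurable _ _ (hB.measurableSet j)
  have hAi : ∀ i, Integrable ((A i).indicator fun _ => (1 : ℝ)) P :=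
    fun i => integrable_indicator_one (hAm i)
  set b : Fin J → Ω → ℝ := fun j ω => (B j).indicator (fun _ => (1 : ℝ)) ω - P.real (B j) with hb
  have hbm : ∀ j, StronglyMeasurable[futureSigma Y (t + 1 + n)] (b j) := fun j =>
    (stronglyMeasurable_indicator_one (hB.measurableSet j)).sub stronglyMeasurable_const
  have hfut : futureSigma Y (t + 1 + n) ≤ futureSigma Y (t + 1) := futureSigma_anti (by linarith)
  have hb1 : ∀ j ω, |b j ω| ≤ 1 := by
    intro j ω
    have h1 : P.real (B j) ≤ 1 := measureReal_le_one
    have h0 : 0 ≤ P.real (B j) := measureReal_nonneg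
    by_cases h : ω ∈ B j <;> simp only [hb, h, Set.indicator_of_mem, Set.indicator_of_notMem,
      not_false_eq_true, abs_le] <;> constructor <;> linarith
  have hbi : ∀ j, Integrable (b j) P := fun j =>
    (integrable_indicator_one (hBm j)).sub (integrable_const _)
  have hb0 : ∀ j, ∫ ω, b j ω ∂P = 0 := by
    intro j
    simp only [hb]
    rw [integral_sub (integrable_indicator_one (hBm j)) (integrable_const _),
      integral_indicator_const _ (hBm j)]
    simp
  -- the predictions of the two partitions from `Y t` and `Y (t + 1)`, as functions on the line
  have hexa : ∀ i, ∃ f : ℝ → ℝ, Measurable f ∧ P[(A i).indicator (fun _ => (1 : ℝ)) |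
      MeasurableSpace.comap (Y t) inferInstance] = f ∘ Y t := fun i =>
    stronglyMeasurable_condExp.measurable.exists_eq_measurable_comp
  have hexh : ∀ j, ∃ g : ℝ → ℝ, Measurable g ∧ P[b j |
      MeasurableSpace.comap (Y (t + 1)) inferInstance] = g ∘ Y (t + 1) := fun j =>
    stronglyMeasurable_condExp.measurable.exists_eq_measurable_comp
  choose f hf hfA using hexa
  choose g hg hgB using hexh
  have hf0 : ∀ᵐ ω ∂P, ∀ i, 0 ≤ f i (Y t ω) := by
    refine ae_all_iff.2 fun i => ?_
    have := condExp_nonneg (μ := P) (m := MeasurableSpace.comap (Y t) inferInstance)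
      (ae_of_all P (Set.indicator_nonneg (s := A i) (f := fun _ => (1 : ℝ))
        fun _ _ => zero_le_one))
    rw [hfA] at this
    exact this
  have hf1 : ∀ᵐ ω ∂P, ∑ i, f i (Y t ω) ≤ 1 := by
    have h := condExp_finsetSum (μ := P) (s := Finset.univ) (fun i _ => hAi i)
      (MeasurableSpace.comap (Y t) inferInstance)
    have hone : ∑ i, (A i).indicator (fun _ => (1 : ℝ)) = fun _ => (1 : ℝ) := by
      ext ω
      rw [Finset.sum_apply, hA.sum_indicator]
    rw [hone, condExp_const hX.comap_le] at h
    filter_upwards [h] with ω hω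
    simp only [hfA, Finset.sum_apply, Function.comp_apply] at hω
    exact hω.symm.le
  have hg1 : ∀ j, ∀ᵐ ω ∂P, |g j (Y (t + 1) ω)| ≤ 1 := by
    intro j
    have : ∀ᵐ ω ∂P, |(P[b j | MeasurableSpace.comap (Y (t + 1)) inferInstance]) ω| ≤ 1 :=
      ae_bdd_abs_condExp_of_ae_bdd_abs (ae_of_all _ (hb1 j))
    rw [hgB] at this
    exact this
  have hfQ0 : ∀ᵐ u, ∀ i, 0 ≤ f i (quantile P (Y t) u) :=
    ae_all_iff.2 fun i => ae_comp_quantile (p := fun x => 0 ≤ f i x) hX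
      (measurableSet_le measurable_const (hf i)) (ae_all_iff.1 hf0 i)
  have hfQ1 : ∀ᵐ u, ∑ i, f i (quantile P (Y t) u) ≤ 1 :=
    ae_comp_quantile (p := fun x => ∑ i, f i x ≤ 1) hX
      (measurableSet_le (Finset.measurable_fun_sum _ fun i _ => hf i) measurable_const) hf1
  have hgQ1 : ∀ j, ∀ᵐ v, |g j (quantile P (Y (t + 1)) v)| ≤ 1 := fun j =>
    ae_comp_quantile (p := fun x => |g j x| ≤ 1) hX'
      (measurableSet_le (hg j).abs measurable_const) (hg1 j)
  have hfm : ∀ i, Measurable fun u => f i (quantile P (Y t) u) :=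
    fun i => (hf i).comp (measurable_quantile hX)
  have hgm : ∀ j, Measurable fun v => g j (quantile P (Y (t + 1)) v) :=
    fun j => (hg j).comp (measurable_quantile hX')
  have hw2 : MemLp (fun z => c z - 1) 2 (volume : Measure (unitInterval × unitInterval)) :=
    hc2.sub (memLp_const 1)
  have hterm : ∀ i j, P.real (A i ∩ B j) - P.real (A i) * P.real (B j) =
      ∫ z, (c z - 1) * (f i (quantile P (Y t) z.1) * g j (quantile P (Y (t + 1)) z.2)) := by
    intro i j
    have h1 : P.real (A i ∩ B j) - P.real (A i) * P.real (B j) =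
        ∫ ω, (A i).indicator (fun _ => (1 : ℝ)) ω * b j ω ∂P := by
      rw [integral_indicator_one_mul (hAm i)]
      simp only [hb]
      rw [integral_sub (integrable_indicator_one (hBm j)).integrableOn
        (integrable_const _).integrableOn, setIntegral_indicator (hBm j)]
      simp
    have hFi : MemLp (fun z : unitInterval × unitInterval =>
        f i (quantile P (Y t) z.1) * g j (quantile P (Y (t + 1)) z.2)) 2 volume := by
      refine memLp_mul_prod_of_abs_le_one (hfm i) (hgm j) ?_ (hgQ1 j)
      filter_upwards [hfQ0, hfQ1] with u h0 h1
      rw [abs_of_nonneg (h0 i)]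
      exact (Finset.single_le_sum (fun i _ => h0 i) (Finset.mem_univ i)).trans h1
    -- the uniform law does not see the product, because the second factor is centred
    have hprod : ∫ z : unitInterval × unitInterval,
        f i (quantile P (Y t) z.1) * g j (quantile P (Y (t + 1)) z.2) = 0 := by
      have hg0 : ∫ v, g j (quantile P (Y (t + 1)) v) = 0 := by
        rw [integral_comp_quantile hX' (hg j)]
        have h := integral_condExp (μ := P) (f := b j) hX'.comap_le
        rw [hgB, hb0] at h
        exact h
      rw [Measure.volume_eq_prod, integral_prod_mul (fun u => f i (quantile P (Y t) u))
        (fun v => g j (quantile P (Y (t + 1)) v)), hg0, mul_zero]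
    rw [h1, integral_indicator_mul_eq hY (hA.measurableSet i) ((hbm j).mono hfut)
      (ae_of_all _ (hb1 j)), hfA, hgB]
    simp only [Function.comp_apply]
    rw [(hC t).integral_mul hX hX' (hf i) (hg j), integral_law_eq hc]
    simp_rw [sub_mul, one_mul]
    have hcF : Integrable (fun z => c z *
        (f i (quantile P (Y t) z.1) * g j (quantile P (Y (t + 1)) z.2))) volume :=
      hc2.integrable_mul hFi
    rw [integral_sub hcF (hFi.integrable one_le_two), hprod, sub_zero]
  simp_rw [hterm]
  refine sum_abs_integral_mul_le hw2 hfm hgm hfQ0 hfQ1 hgQ1 (pow_nonneg hη n) fun s hs => ?_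
  rw [integral_comp_quantile (f := fun x => (∑ j, s j * g j x) ^ 2) hX'
    ((Finset.measurable_fun_sum _ fun j _ => (hg j).const_mul _).pow_const 2)]
  set Z : Ω → ℝ := ∑ j, s j • b j with hZdef
  have hZω : ∀ ω, Z ω = ∑ j, s j * b j ω := fun ω => by
    simp [hZdef, Finset.sum_apply]
  have hZm : StronglyMeasurable[futureSigma Y (t + 1 + n)] Z :=
    Finset.stronglyMeasurable_sum _ fun j _ => (hbm j).const_smul _
  have hZK : ∀ ω, |Z ω| ≤ J := by
    intro ω
    rw [hZω]
    refine (Finset.abs_sum_le_sum_abs _ _).trans ?_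
    calc ∑ j, |s j * b j ω| ≤ ∑ _j : Fin J, (1 : ℝ) := Finset.sum_le_sum fun j _ => by
          rw [abs_mul]; exact mul_le_one₀ (hs j) (abs_nonneg _) (hb1 j ω)
      _ = J := by simp
  have hZ0 : ∫ ω, Z ω ∂P = 0 := by
    simp_rw [hZω]
    rw [integral_finsetSum _ fun j _ => (hbi j).const_mul _]
    simp [integral_const_mul, hb0]
  have hZc : ∀ᵐ ω ∂P, (P[Z | MeasurableSpace.comap (Y (t + 1)) inferInstance]) ω =
      ∑ j, s j * g j (Y (t + 1) ω) := by
    have h := condExp_finsetSum (μ := P) (s := Finset.univ) (fun j _ => (hbi j).smul (s j))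
      (MeasurableSpace.comap (Y (t + 1)) inferInstance)
    have h' : ∀ᵐ ω ∂P, ∀ j, (P[s j • b j | MeasurableSpace.comap (Y (t + 1)) inferInstance]) ω =
        s j * g j (Y (t + 1) ω) := by
      refine ae_all_iff.2 fun j => (condExp_smul (s j) (b j)
        (MeasurableSpace.comap (Y (t + 1)) inferInstance)).mono fun ω hω => ?_
      rw [hω, hgB]
      rfl
    filter_upwards [h, h'] with ω hω hω'
    rw [hω, Finset.sum_apply]
    exact Finset.sum_congr rfl fun j _ => hω' j
  calc ∫ ω, (∑ j, s j * g j (Y (t + 1) ω)) ^ 2 ∂P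
      = ∫ ω, (P[Z | MeasurableSpace.comap (Y (t + 1)) inferInstance]) ω ^ 2 ∂P :=
        integral_congr_ae (hZc.mono fun ω hω => by simp only; rw [hω])
    _ ≤ (η ^ n) ^ 2 * ∫ ω, Z ω ^ 2 ∂P :=
        integral_condExp_sq_le_pow hY hC hη hCη hZm (ae_of_all _ hZK) hZ0 n _ rfl
    _ ≤ (η ^ n) ^ 2 * 1 := by
        refine mul_le_mul_of_nonneg_left ?_ (sq_nonneg _)
        simp_rw [hZω]
        exact hB.integral_sum_sq_le (futureSigma_le hY.measurable _) hs
    _ = (η ^ n) ^ 2 := mul_one _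

end Decay

theorem theorem1 {Ω : Type*} [MeasurableSpace Ω] (P : Measure Ω) [IsProbabilityMeasure P]
    (Y : ℤ → Ω → ℝ) (hY : IsMarkovProcess P Y)
    (C : ℤ → Copula) (hC : ∀ t, IsCopulaOf (C t) P (Y t) (Y (t + 1)))
    (c : ℤ → unitInterval × unitInterval → ℝ) (hc : ∀ t, (C t).HasDensity (c t))
    (hsymm : ∀ t, ∀ᵐ z, c t z.swap = c t z)
    (hL2 : ∀ t, MemLp (c t) 2 volume)
    (hbdd : ∃ M : ℝ≥0, ∀ t, eLpNorm (c t) 2 volume ≤ M)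
    (hη : (⨆ t, (C t).maxCorr) < 1) :
    IsBetaMixing P Y ∧
      ∀ k : ℕ, 1 ≤ k →
        betaMix P Y k ≤ 1 / 2 * (⨆ t, (C t).maxCorr) ^ (k - 1) *
          ⨆ t, eLpNorm (fun z => c t z - 1) 2 volume := by
  set η : ℝ≥0∞ := ⨆ t, (C t).maxCorr with hηdef
  set D : ℝ≥0∞ := ⨆ t, eLpNorm (fun z => c t z - 1) 2 volume with hD
  have hηr : ENNReal.ofReal η.toReal = η := ENNReal.ofReal_toReal hη.ne_top
  have hCη : ∀ t, (C t).maxCorr ≤ ENNReal.ofReal η.toReal := fun t => by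
    rw [hηr]; exact le_iSup (fun t => (C t).maxCorr) t
  have hbound : ∀ n : ℕ, betaMix P Y (n + 1) ≤ 1 / 2 * η ^ n * D := by
    intro n
    refine iSup_le fun t => iSup_le fun I => iSup_le fun J => iSup_le fun A => iSup_le fun B =>
      iSup_le fun hA => iSup_le fun hB => ?_
    rw [show t + ((n + 1 : ℕ) : ℤ) = t + 1 + n by push_cast; ring] at hB
    have h := sum_abs_measureReal_inter_sub_le hY hC ENNReal.toReal_nonneg hCη (hc t) (hL2 t) n
      hA hB
    have hL : eLpNorm (fun z => c t z - 1) 2 volume ≤ D :=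
      le_iSup (fun t => eLpNorm (fun z => c t z - 1) 2 volume) t
    have hw2 : MemLp (fun z => c t z - 1) 2 volume := (hL2 t).sub (memLp_const 1)
    calc _ ≤ ENNReal.ofReal (1 / 2 * (√(∫ z, (c t z - 1) ^ 2) * η.toReal ^ n)) :=
          ENNReal.ofReal_le_ofReal (mul_le_mul_of_nonneg_left h (by norm_num))
      _ = 1 / 2 * η ^ n * eLpNorm (fun z => c t z - 1) 2 volume := by
          rw [ENNReal.ofReal_mul (by norm_num), ENNReal.ofReal_mul (Real.sqrt_nonneg _),
            ofReal_sqrt_integral_sq hw2, ENNReal.ofReal_pow ENNReal.toReal_nonneg, hηr,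
            ENNReal.ofReal_div_of_pos two_pos, ENNReal.ofReal_one, ENNReal.ofReal_ofNat]
          ring
      _ ≤ 1 / 2 * η ^ n * D := by gcongr
  have hDtop : D ≠ ∞ := by
    obtain ⟨M, hM⟩ := hbdd
    refine ne_top_of_le_ne_top (b := (M : ℝ≥0∞) + 1) (by simp) (iSup_le fun t => ?_)
    refine (eLpNorm_sub_le (hL2 t).aestronglyMeasurable aestronglyMeasurable_const
      one_le_two).trans (add_le_add (hM t) ?_)
    rw [eLpNorm_const _ two_ne_zero (NeZero.ne _)]
    simp
  refine ⟨?_, fun k hk => ?_⟩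
  · refine (tendsto_add_atTop_iff_nat 1).1 ?_
    refine tendsto_of_tendsto_of_tendsto_of_le_of_le tendsto_const_nhds ?_
      (fun _ => zero_le) hbound
    have h := (ENNReal.tendsto_pow_atTop_nhds_zero_of_lt_one hη)
    have h1 := ENNReal.Tendsto.const_mul (a := 1 / 2) h (Or.inr (by norm_num))
    have h2 := ENNReal.Tendsto.mul_const (b := D) h1 (Or.inr hDtop)
    simpa using h2
  · obtain ⟨n, rfl⟩ := Nat.exists_eq_add_of_le' hk
    simpa using hbound n
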